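/- Let $L$ be a finite-dimensional Lie algebra over $\mathbb{Q}$ and $f$ a Lie algebra automorphism of $L$. Call $f$ \emph{Anosov} if it is hyperbolic (no complex eigenvalue of $f$ has absolute value $1$) and integer-like (the characteristic polynomial of $f$ has integer coefficients and $|\det f| = 1$). Its signature is the set $\mathrm{sg}(f) = \{p,q\}$, where $p$ and $q$ are the numbers of complex eigenvalues of $f$, counted with multiplicity, of absolute value $<1$ and $>1$ respectively. Put $\gamma_1(L) = L$ and $\gamma_{i+1}(L) = [L,\gamma_i(L)]$; $L$ has nilpotency class $c \ge 1$ if $\gamma_{c+1}(L) = 0$ and $\gamma_c(L) \neq 0$, and its type is then the $c$-tuple with entries $\dim_{\mathbb{Q}} \gamma_i(L)/\gamma_{i+1}(L)$, $1 \le i \le c$. A unit Pisot number in a Galois extension $E \subseteq \mathbb{R}$ of $\mathbb{Q}$ is an algebraic unit $\lambda \in E$ with $\lambda > 1$ and $|\tau(\lambda)| < 1$ for all $1 \ne \tau \in \mathrm{Gal}(E,\mathbb{Q})$. \textbf{Theorem.} For all integers $c \ge 1$ and $n \ge 2$ there exist a Galois extension $E \subseteq \mathbb{R}$ of $\mathbb{Q}$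 of degree $2n$ with cyclic Galois group generated by an element $\sigma$, a unit Pisot number $\lambda \in E$, a finite-dimensional rational Lie algebra $L$ of nilpotency class $c$ and of type $$(m_1, m_2, m_3, \ldots, m_c) = (2n, n, 2n, \ldots, 2n) \qquad (m_2 = n,\ m_j = 2n \text{ for } j \neq 2),$$ and an Anosov automorphism $f$ of $L$ such that $\min(\mathrm{sg}(f)) = c$ and such that the characteristic polynomial of $f$ is $$\prod_{j=1}^{c}\ \prod_{i=1}^{m_j} \bigl(X - \sigma^i(\lambda)^{\,j-1}\,\sigma^{i+n}(\lambda)\bigr).$$ In particular, for every $c \ge 1$ there is an Anosov automorphism of minimal signature on a rational Lie algebra of nilpotency class $c$, and (taking $c = 2$) there is one of signature $\{2,k\}$, for some $k$, on a non-abelian Lie algebra. -/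

import Mathlib

namespace AnosovLie

section Automorphisms

variable {L : Type*} [LieRing L] [LieAlgebra ℚ L] [FiniteDimensional ℚ L]

/-- The underlying linear endomorphism of a Lie algebra automorphism. -/
abbrev toEndo (f : L ≃ₗ⁅ℚ⁆ L) : Module.End ℚ L := f.toLinearEquiv.toLinearMap

/-- The complex eigenvalues of `f`, with (algebraic) multiplicity. -/
noncomputable def eigenvalues (f : L ≃ₗ⁅ℚ⁆ L) : Multiset ℂ :=
  (toEndo f).charpoly.aroots ℂ

/-- `f` is hyperbolic: it has no eigenvalue of absolute value `1`. -/
def IsHyperbolic (f : L ≃ₗ⁅ℚ⁆ L) : Prop :=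
  ∀ z ∈ eigenvalues f, ‖z‖ ≠ 1

/-- `f` is integer-like: its characteristic polynomial has coefficients in `ℤ` and its
determinant has absolute value `1`. -/
def IsIntegerLike (f : L ≃ₗ⁅ℚ⁆ L) : Prop :=
  (∀ k : ℕ, ∃ a : ℤ, (toEndo f).charpoly.coeff k = (a : ℚ)) ∧ |LinearMap.det (toEndo f)| = 1

/-- An Anosov automorphism is a hyperbolic, integer-like automorphism. -/
def IsAnosov (f : L ≃ₗ⁅ℚ⁆ L) : Prop :=
  IsHyperbolic f ∧ IsIntegerLike f

/-- The number of eigenvalues of absolute value `< 1`, counted with multiplicity. -/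
noncomputable def stableDim (f : L ≃ₗ⁅ℚ⁆ L) : ℕ :=
  ((eigenvalues f).map (fun z => ‖z‖)).countP (fun r => r < 1)

/-- The number of eigenvalues of absolute value `> 1`, counted with multiplicity. -/
noncomputable def unstableDim (f : L ≃ₗ⁅ℚ⁆ L) : ℕ :=
  ((eigenvalues f).map (fun z => ‖z‖)).countP (fun r => 1 < r)

/-- The signature `sg(f) = {p, q}`, an unordered set. -/
def signature (f : L ≃ₗ⁅ℚ⁆ L) : Set ℕ :=
  {stableDim f, unstableDim f}

end Automorphisms

section NilpotentLieAlgebras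

variable (L : Type*) [LieRing L] [LieAlgebra ℚ L]

/-- `L` is nilpotent of class `c`: with `γ₁(L) = L` and `γᵢ₊₁(L) = [L, γᵢ(L)]`, the number `c` is
the least one with `γ_{c+1}(L) = 0` (Mathlib's lower central series starts at index `0`). -/
def HasNilpotencyClass (c : ℕ) : Prop :=
  LieRing.IsNilpotent L ∧ LieModule.nilpotencyLength L L = c

/-- The subspace `γᵢ(L)`, for `i ≥ 1`, of the lower central series with `γ₁(L) = L`. -/
def gamma (i : ℕ) : Submodule ℚ L :=
  (LieModule.lowerCentralSeries ℚ L L (i - 1)).toSubmodule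

/-- The dimension of `γᵢ(L) / γᵢ₊₁(L)`, for `i ≥ 1`. -/
noncomputable def typeEntry (i : ℕ) : ℕ :=
  Module.finrank ℚ (gamma L i ⧸ (gamma L (i + 1)).submoduleOf (gamma L i))

/-- The type `(n₁, …, n_c)` of a nilpotent Lie algebra `L`, where `c` is its nilpotency class and
`nᵢ = dim γᵢ(L) / γᵢ₊₁(L)`. -/
noncomputable def lieType : List ℕ :=
  List.ofFn (fun k : Fin (LieModule.nilpotencyLength L L) => typeEntry L (k + 1))

end NilpotentLieAlgebras

/-- A unit Pisot number in a real field `E` (in use: a real Galois extension of `ℚ`): an algebraic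
unit `x > 1` all of whose images under nontrivial elements of `Gal(E, ℚ)` have absolute
value `< 1`. -/
def IsUnitPisot (E : IntermediateField ℚ ℝ) (x : E) : Prop :=
  IsIntegral ℤ x ∧ IsIntegral ℤ x⁻¹ ∧ 1 < (x : ℝ) ∧
    ∀ τ : E ≃ₐ[ℚ] E, τ ≠ 1 → |((τ x : E) : ℝ)| < 1

/-- The entry at position `j ≥ 1` of the tuple `(2n, n, 2n, …, 2n)`. -/
def minimalTypeEntry (n j : ℕ) : ℕ :=
  if j = 2 then n else 2 * n

end AnosovLie

/-! Let `E` be a real cyclic field of degree `2n` and `τ = σ ^ n` its involution. Grade `L` by `c`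
copies of `E`, indexed from `0`, with the copy of index `1` cut down to the `(-1)`-eigenspace of
`τ`, of dimension `n`. An element `x` of index `0` maps each positive index `k` to `k + 1` as
multiplication by `τ x`; two elements of index `0` bracket to `τ x * y - τ y * x`, and positive
indices commute. Each bracket with index `0` raises the index by one, so the lower central series is
the index filtration (`lowerCentralSeries_eq_filtration`).

Multiplication by `a ^ k * τ a` on index `k` is an automorphism, because `τ (τ a) = a` is exactly
the factor gained in one bracket. Its eigenvalues are the conjugates of `a ^ k * τ a`, only half of
them for `k = 1`, where `τ` fixes `a * τ a`.

For a unit Pisot number `a = λ`, integrality is automatic, and a product of conjugates that does not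
involve `λ` itself is contracting. On index `k` only `λ ^ k * τ λ` and `(τ λ) ^ k * λ` can involve
`λ`. If `|τ λ|` lies between `λ⁻¹` and `λ ^ (-1/2)`, the first expands exactly for `k ≥ 1` and the
second exactly for `k ≤ 1`; for `k = 1` they coincide. So every index carries exactly one expanding
eigenvalue, `c` in all. Dirichlet's unit theorem supplies such a `λ` (`exists_unitPisot`). -/

namespace AnosovLie

/-! ### Real cyclic fields of given degree -/

open NumberField NumberField.Units NumberField.Units.dirichletUnitTheorem Module

/-- For every `d ≥ 1` there is a real cyclic extension of `ℚ` of degree `d`. -/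
theorem exists_real_cyclic_extension (d : ℕ) (hd : d ≠ 0) :
    ∃ E : IntermediateField ℚ ℝ, finrank ℚ E = d ∧ IsGalois ℚ E ∧ IsCyclic (E ≃ₐ[ℚ] E) := by
  -- With `p - 1 = 2 * d * m`, the field of degree `d` is fixed by the subgroup of order `2 * m`.
  -- The factor `2` puts complex conjugation into this subgroup, so the field is real.
  obtain ⟨p, hp, -, hmod⟩ := Nat.exists_prime_gt_modEq_one (k := 2 * d) 1 (by omega)
  obtain ⟨m, hm⟩ : 2 * d ∣ p - 1 := (Nat.modEq_iff_dvd' hp.one_lt.le).mp hmod.symm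
  have hm0 : 0 < m := by
    rcases Nat.eq_zero_or_pos m with rfl | h
    · have := hp.one_lt
      omega
    · exact h
  have : NeZero p := ⟨hp.ne_zero⟩
  let K := CyclotomicField p ℚ
  have : IsCyclotomicExtension {p} ℚ K := CyclotomicField.isCyclotomicExtension p ℚ
  have : IsGalois ℚ K := IsCyclotomicExtension.isGalois {p} ℚ K
  let e : (K ≃ₐ[ℚ] K) ≃* (ZMod p)ˣ := IsCyclotomicExtension.Rat.galEquivZMod p K
  have hcycU : IsCyclic (ZMod p)ˣ := ZMod.isCyclic_units_prime hp
  have hcyc : IsCyclic (K ≃ₐ[ℚ] K) := e.isCyclic.mpr hcycU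
  have hcardG : Nat.card (K ≃ₐ[ℚ] K) = p - 1 := by
    rw [IsGalois.card_aut_eq_finrank, IsCyclotomicExtension.Rat.finrank p K, Nat.totient_prime hp]
  let : CommGroup (K ≃ₐ[ℚ] K) := hcyc.commGroup
  let H : Subgroup (K ≃ₐ[ℚ] K) := (powMonoidHom (2 * m) : (K ≃ₐ[ℚ] K) →* _).ker
  have hcardH : Nat.card H = 2 * m := by
    rw [IsCyclic.card_powMonoidHom_ker, hcardG, hm]
    exact Nat.gcd_eq_right ⟨d, by ring⟩
  let F : IntermediateField ℚ K := IntermediateField.fixedField H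
  have hF : finrank ℚ F = d := by
    have h1 : finrank F K = 2 * m := by
      rw [IntermediateField.finrank_fixedField_eq_card, hcardH]
    have h2 := finrank_mul_finrank ℚ F K
    rw [h1, IsCyclotomicExtension.Rat.finrank p K, Nat.totient_prime hp, hm] at h2
    exact Nat.eq_of_mul_eq_mul_right (by omega : 0 < 2 * m) (by rw [h2]; ring)
  have hFG : IsGalois ℚ F := IsGalois.of_fixedField_normal_subgroup H
  have hFc : IsCyclic (F ≃ₐ[ℚ] F) :=
    isCyclic_of_surjective _ (AlgEquiv.restrictNormalHom_surjective (F := ℚ) (K₁ := F) K)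
  let φ : K →ₐ[ℚ] ℂ := IsAlgClosed.lift
  let : Algebra K ℂ := φ.toRingHom.toAlgebra
  have : IsScalarTower ℚ K ℂ := IsScalarTower.of_algebraMap_eq fun x => (φ.commutes x).symm
  let conj : ℂ →ₐ[ℚ] ℂ := Complex.conjAe.toAlgHom.restrictScalars ℚ
  let κ : K ≃ₐ[ℚ] K := AlgHom.restrictNormal' conj K
  have hκ : ∀ x, φ (κ x) = (starRingEnd ℂ) (φ x) := fun x => conj.restrictNormal_commutes K x
  have hκ2 : κ ^ 2 = 1 := by
    ext x
    apply φ.toRingHom.injective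
    change φ (κ (κ x)) = φ x
    rw [hκ, hκ, Complex.conj_conj]
  have hκH : κ ∈ H := by
    change κ ^ (2 * m) = 1
    rw [pow_mul, hκ2, one_pow]
  have hreal : ∀ x : F, (((φ x).re : ℝ) : ℂ) = φ x := fun x => by
    rw [← Complex.conj_eq_iff_re, ← hκ]
    exact congrArg φ (x.2 ⟨κ, hκH⟩)
  -- Taking real parts is multiplicative here because `φ` is real-valued on `F`.
  let ψ : F →ₐ[ℚ] ℝ := AlgHom.ofLinearMap
    { toFun := fun x => (φ x).re
      map_add' := fun x y => by simp
      map_smul' := fun r x => by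
        apply Complex.ofReal_injective
        simp only [hreal, RingHom.id_apply]
        rw [Algebra.smul_def, Algebra.smul_def]
        push_cast [hreal]
        simp }
    (by simp) (fun x y => by
      apply Complex.ofReal_injective
      simp only [LinearMap.coe_mk, AddHom.coe_mk, Complex.ofReal_mul, hreal]
      simp)
  let g : F ≃ₐ[ℚ] ψ.fieldRange := AlgEquiv.ofInjectiveField ψ
  exact ⟨ψ.fieldRange, by rw [← hF]; exact g.toLinearEquiv.finrank_eq.symm,
    IsGalois.of_algEquiv g, (AlgEquiv.autCongr g).isCyclic.mp hFc⟩

/-! ### Dirichlet's unit theorem as an approximation statement -/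

section UnitLattice

variable (K : Type*) [Field K] [NumberField K]

open scoped Classical in
/-- Every vector of the logarithmic trace-zero space is at bounded distance from the logarithm of
a unit. -/
theorem exists_unit_log_near :
    ∃ C : ℝ, 0 ≤ C ∧ ∀ v : InfinitePlace K → ℝ, ∑ w, v w = 0 →
      ∃ u : (𝓞 K)ˣ, ∀ w : InfinitePlace K,
        |w.mult * Real.log (w (u : K)) - v w| ≤ C := by
  let b := (basisUnitLattice K).ofZLatticeBasis ℝ (unitLattice K)
  let r : ℝ := ∑ i, ‖b i‖
  have hr : 0 ≤ r := Finset.sum_nonneg fun _ _ => norm_nonneg _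
  -- Rounding to the unit lattice costs at most `r` at each place other than `w₀`. The coordinate at
  -- `w₀` is minus the sum of the others, both for `v` and for the unit, so its error is at most the
  -- number of places times `r`.
  refine ⟨r + Fintype.card (InfinitePlace K) * r, by positivity, fun v hv => ?_⟩
  let v' : logSpace K := fun w => v w
  have hmem : ((ZSpan.floor b v' : Submodule.span ℤ (Set.range b)) : logSpace K) ∈
      unitLattice K := by
    rw [← (basisUnitLattice K).ofZLatticeBasis_span ℝ (unitLattice K)]
    exact (ZSpan.floor b v').2
  obtain ⟨u, -, hu⟩ := hmem
  have hnorm : ‖v' - logEmbedding K u‖ ≤ r := by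
    have := ZSpan.norm_fract_le b v'
    rw [ZSpan.fract_apply, ← hu] at this
    exact this
  have hcoord : ∀ w : {w : InfinitePlace K // w ≠ w₀},
      |w.1.mult * Real.log (w.1 (u.toMul : K)) - v w| ≤ r := fun w => by
    have := (norm_le_pi_norm (v' - logEmbedding K u) w).trans hnorm
    rw [Real.norm_eq_abs, Pi.sub_apply, abs_sub_comm] at this
    exact this
  refine ⟨u.toMul, fun w => ?_⟩
  by_cases hw : w = w₀
  · have h1 := sum_mult_mul_log u.toMul
    rw [Fintype.sum_eq_add_sum_subtype_ne _ w₀] at h1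
    rw [Fintype.sum_eq_add_sum_subtype_ne _ w₀] at hv
    have h2 : |∑ w : {w : InfinitePlace K // w ≠ w₀},
        (w.1.mult * Real.log (w.1 (u.toMul : K)) - v w)| ≤ Fintype.card (InfinitePlace K) * r := by
      refine (Finset.abs_sum_le_sum_abs _ _).trans
        ((Finset.sum_le_card_nsmul _ _ r fun w _ => hcoord w).trans ?_)
      rw [nsmul_eq_mul]
      refine mul_le_mul_of_nonneg_right ?_ hr
      exact_mod_cast Fintype.card_subtype_le _
    rw [Finset.sum_sub_distrib] at h2
    subst hw
    rw [← abs_neg]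
    refine le_trans (le_of_eq ?_) (h2.trans (by linarith))
    congr 1
    linarith
  · exact (hcoord ⟨w, hw⟩).trans (le_add_of_nonneg_right (by positivity))

end UnitLattice

/-! ### Infinite places of a real Galois field -/

section RealGalois

variable (E : IntermediateField ℚ ℝ)

/-- The infinite place of a real field `E` given by `x ↦ |τ x|`. -/
noncomputable def placeOf (τ : E ≃ₐ[ℚ] E) : InfinitePlace E :=
  InfinitePlace.mk ((Complex.ofRealHom.comp (algebraMap E ℝ)).comp (τ : E →+* E))

variable {E}

theorem placeOf_apply (τ : E ≃ₐ[ℚ] E) (x : E) : placeOf E τ x = |((τ x : E) : ℝ)| := by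
  rw [placeOf, InfinitePlace.apply]
  exact Complex.norm_real _

theorem isReal_embedding (τ : E ≃ₐ[ℚ] E) : ComplexEmbedding.IsReal
    ((Complex.ofRealHom.comp (algebraMap E ℝ)).comp (τ : E →+* E)) := by
  ext x
  exact Complex.conj_ofReal _

theorem mult_placeOf (τ : E ≃ₐ[ℚ] E) : (placeOf E τ).mult = 1 :=
  InfinitePlace.mult_isReal ⟨_, InfinitePlace.isReal_mk_iff.mpr (isReal_embedding τ)⟩

theorem placeOf_injective : Function.Injective (placeOf E) := by
  intro τ τ' h
  have h' := InfinitePlace.mk_eq_iff.mp h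
  rw [ComplexEmbedding.isReal_iff.mp (isReal_embedding τ), or_self] at h'
  ext x
  exact Complex.ofReal_injective (RingHom.congr_fun h' x)

theorem placeOf_bijective [FiniteDimensional ℚ E] [IsGalois ℚ E] : Function.Bijective (placeOf E) := by
  have : NumberField E := ⟨⟩
  refine (Fintype.bijective_iff_injective_and_card _).mpr ⟨placeOf_injective, ?_⟩
  -- The group has order `r₁ + 2 * r₂`, which is at least the number `r₁ + r₂` of places.
  refine le_antisymm (Fintype.card_le_of_injective _ placeOf_injective) ?_
  rw [← Nat.card_eq_fintype_card, ← Nat.card_eq_fintype_card, IsGalois.card_aut_eq_finrank,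
    ← InfinitePlace.card_add_two_mul_card_eq_rank, Nat.card_eq_fintype_card,
    InfinitePlace.card_eq_nrRealPlaces_add_nrComplexPlaces]
  omega

/-- The conjugates of units of a real Galois field approximate any prescribed growth. -/
theorem exists_unit_log_conj_near [FiniteDimensional ℚ E] [IsGalois ℚ E] :
    ∃ C : ℝ, 0 ≤ C ∧ ∀ v : (E ≃ₐ[ℚ] E) → ℝ, ∑ τ, v τ = 0 →
      ∃ x : E, x ≠ 0 ∧ IsIntegral ℤ x ∧ IsIntegral ℤ x⁻¹ ∧
        ∀ τ : E ≃ₐ[ℚ] E, |Real.log |((τ x : E) : ℝ)| - v τ| ≤ C := by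
  have : NumberField E := ⟨⟩
  obtain ⟨C, hC, h⟩ := exists_unit_log_near E
  let e := Equiv.ofBijective _ (placeOf_bijective (E := E))
  refine ⟨C, hC, fun v hv => ?_⟩
  obtain ⟨u, hu⟩ := h (fun w => v (e.symm w)) (by rw [Equiv.sum_comp e.symm v, hv])
  refine ⟨(u : 𝓞 E), by simp, RingOfIntegers.isIntegral_coe _, ?_, fun τ => ?_⟩
  · have : (((u : 𝓞 E) : E))⁻¹ = ((u⁻¹ : (𝓞 E)ˣ) : 𝓞 E) := by
      rw [inv_eq_iff_eq_inv, eq_comm, inv_eq_of_mul_eq_one_left]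
      exact_mod_cast congrArg (algebraMap (𝓞 E) E) (u.mul_inv)
    rw [this]
    exact RingOfIntegers.isIntegral_coe _
  · have := hu (e τ)
    rw [Equiv.symm_apply_apply] at this
    have h2 : e τ = placeOf E τ := rfl
    rw [h2, mult_placeOf, placeOf_apply, Nat.cast_one, one_mul] at this
    exact this

end RealGalois

end AnosovLie

/-! ### Unit Pisot numbers with one controlled conjugate -/

namespace AnosovLie

open Module

/-- In a real Galois extension of degree at least `3` there is a unit Pisot number with a prescribed
conjugate of absolute value strictly between `x⁻¹` and `x ^ (-1/2)`. -/
theorem exists_unitPisot {E : IntermediateField ℚ ℝ} [FiniteDimensional ℚ E] [IsGalois ℚ E]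
    (hE : 3 ≤ finrank ℚ E) (ρ : E ≃ₐ[ℚ] E) (hρ : ρ ≠ 1) :
    ∃ x : E, IsUnitPisot E x ∧ 1 < (x : ℝ) * |((ρ x : E) : ℝ)| ∧
      (x : ℝ) * |((ρ x : E) : ℝ)| ^ 2 < 1 := by
  classical
  obtain ⟨C, hC, h⟩ := exists_unit_log_conj_near (E := E)
  have hcard : Fintype.card (E ≃ₐ[ℚ] E) = finrank ℚ E := by
    rw [← Nat.card_eq_fintype_card, IsGalois.card_aut_eq_finrank]
  have hd : (3 : ℝ) ≤ finrank ℚ E := by exact_mod_cast hE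
  generalize finrank ℚ E = d at hcard hd
  -- The target logarithms are `3 * M` at `1`, `-2 * M` at `ρ` and `-t` elsewhere; they sum to zero
  -- since `M = (d - 2) * t`. The two products have target logarithms `M` and `-M`, with errors at
  -- most `2 * C` and `3 * C`, absorbed because `M ≥ t > 4 * C`.
  obtain ⟨t, ht⟩ : ∃ t : ℝ, t = 4 * C + 1 := ⟨_, rfl⟩
  obtain ⟨M, hM⟩ : ∃ M : ℝ, M = (d - 2) * t := ⟨_, rfl⟩
  have hMt : t ≤ M := by nlinarith
  obtain ⟨x, hx0, hxi, hxi', hx⟩ := h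
    (fun τ => -t + (if τ = 1 then 3 * M + t else 0) + (if τ = ρ then -2 * M + t else 0)) (by
      simp only [Finset.sum_add_distrib, Finset.sum_const, Finset.sum_ite_eq', Finset.mem_univ,
        if_true, Finset.card_univ, hcard, nsmul_eq_mul]
      rw [hM]
      ring)
  have habs0 : ∀ τ : E ≃ₐ[ℚ] E, 0 < |((τ x : E) : ℝ)| := fun τ => by
    rw [abs_pos]
    exact_mod_cast (map_ne_zero τ).mpr hx0
  have h1 := abs_le.mp (hx 1)
  have h2 := abs_le.mp (hx ρ)
  rw [if_pos rfl, if_neg hρ.symm, AlgEquiv.one_apply] at h1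
  have hp : 0 < |(x : ℝ)| := habs0 1
  have hq := habs0 ρ
  rw [if_pos rfl, if_neg hρ] at h2
  have hothers : ∀ τ : E ≃ₐ[ℚ] E, τ ≠ 1 → |((τ x : E) : ℝ)| < 1 := fun τ hτ => by
    rw [← Real.log_neg_iff (habs0 τ)]
    by_cases hτρ : τ = ρ
    · subst hτρ
      linarith [h2.2]
    · have h3 := abs_le.mp (hx τ)
      rw [if_neg hτ, if_neg hτρ] at h3
      linarith [h3.2]
  have hone : 1 < |((x : E) : ℝ)| := by
    rw [← Real.log_pos_iff hp.le]
    linarith [h1.1]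
  have hlow : 1 < |(x : ℝ)| * |((ρ x : E) : ℝ)| := by
    rw [← Real.log_pos_iff (by positivity), Real.log_mul hp.ne' (habs0 ρ).ne']
    linarith [h1.1, h2.1]
  have hhigh : |(x : ℝ)| * |((ρ x : E) : ℝ)| ^ 2 < 1 := by
    rw [← Real.log_neg_iff (mul_pos hp (by positivity)), Real.log_mul hp.ne' (by positivity),
      Real.log_pow]
    push_cast
    linarith [h1.2, h2.2]
  rcases le_or_gt 0 (x : ℝ) with hs | hs
  · rw [abs_of_nonneg hs] at hone hlow hhigh
    exact ⟨x, ⟨hxi, hxi', hone, hothers⟩, hlow, hhigh⟩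
  · rw [abs_of_neg hs] at hone hlow hhigh
    refine ⟨-x, ⟨hxi.neg, by rw [inv_neg]; exact hxi'.neg, by simpa using hone,
      fun τ hτ => by simpa using hothers τ hτ⟩, ?_, ?_⟩ <;> rw [map_neg]
    · simpa using hlow
    · simpa using hhigh

/-! ### Products over a cyclic group -/

section Generator

variable {G : Type*} [Group G] {N : ℕ} {σ : G}

theorem orderOf_eq_of_generates (hN : Nat.card G = N) (hσ : ∀ τ : G, τ ∈ Subgroup.zpowers σ) :
    orderOf σ = N := by
  rw [← hN, orderOf_eq_card_of_forall_mem_zpowers hσ]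

theorem prod_pow_generator {M : Type*} [CommMonoid M] [Fintype G] (hN : Nat.card G = N)
    (hσ : ∀ τ : G, τ ∈ Subgroup.zpowers σ) (F : G → M) :
    ∏ i ∈ Finset.Icc 1 N, F (σ ^ i) = ∏ τ, F τ := by
  have ho := orderOf_eq_of_generates hN hσ
  refine Finset.prod_nbij (fun i => σ ^ i) (fun _ _ => Finset.mem_univ _) ?_ ?_ fun _ _ => rfl
  · intro i hi j hj hij
    simp only [Finset.coe_Icc, Set.mem_Icc] at hi hj
    have h := pow_eq_pow_iff_modEq.mp hij
    rw [ho] at h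
    have hle : ∀ a b : ℕ, 1 ≤ a → b ≤ N → a ≤ b → a ≡ b [MOD N] → a = b := fun a b h1 h2 h3 h4 => by
      have h5 := (Nat.modEq_iff_dvd' h3).mp h4
      rcases Nat.eq_zero_or_pos (b - a) with h6 | h6
      · omega
      · have := Nat.le_of_dvd h6 h5
        omega
    rcases le_total i j with hij | hij
    · exact hle i j hi.1 hj.2 hij h
    · exact (hle j i hj.1 hi.2 hij h.symm).symm
  · intro τ _
    have hfin : IsOfFinOrder σ := isOfFinOrder_of_finite σ
    classical
    obtain ⟨k, hk, hkτ⟩ :=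
      Finset.mem_image.mp ((hfin.mem_zpowers_iff_mem_range_orderOf (y := τ)).mp (hσ τ))
    rw [Finset.mem_range, ho] at hk
    simp only [Finset.coe_Icc, Set.mem_image, Set.mem_Icc]
    rcases Nat.eq_zero_or_pos k with rfl | hk0
    · exact ⟨N, ⟨by omega, le_rfl⟩, by rw [← hkτ, pow_zero, ← ho, pow_orderOf_eq_one]⟩
    · exact ⟨k, ⟨hk0, hk.le⟩, hkτ⟩

end Generator

end AnosovLie

/-! ### The graded Lie algebra of an involution -/

namespace AnosovLie

open Module

section AntiInvariants

variable {F E : Type*} [Field F] [Field E] [Algebra F E] (τ : E ≃ₐ[F] E)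

/-- The elements on which `τ` acts as `-1`. -/
def antiInvariants : Submodule F E := LinearMap.ker (τ.toLinearMap + LinearMap.id)

/-- The homogeneous components of the Lie algebra `CyclicLie τ c`. -/
def component (i : ℕ) : Submodule F E := if i = 1 then antiInvariants τ else ⊤

variable {τ}

theorem mem_antiInvariants {x : E} : x ∈ antiInvariants τ ↔ τ x = -x := by
  simp [antiInvariants, add_eq_zero_iff_eq_neg]

theorem mem_component {i : ℕ} {x : E} : x ∈ component τ i ↔ (i = 1 → τ x = -x) := by
  unfold component
  split_ifs with h <;> simp [h, mem_antiInvariants]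

end AntiInvariants

/-- The underlying space of the graded Lie algebra attached to an involution `τ` of `E`: all
components are `E`, except that at index `1` the involution acts as `-1`. -/
def CyclicLie {F E : Type*} [Field F] [Field E] [Algebra F E] (τ : E ≃ₐ[F] E) (c : ℕ) : Type _ :=
  ∀ i : Fin c, component τ i

namespace CyclicLie

variable {F E : Type*} [Field F] [Field E] [Algebra F E] {τ : E ≃ₐ[F] E} {c : ℕ}

instance : AddCommGroup (CyclicLie τ c) :=
  inferInstanceAs (AddCommGroup (∀ i : Fin c, component τ i))

instance : Module F (CyclicLie τ c) :=
  inferInstanceAs (Module F (∀ i : Fin c, component τ i))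

instance [FiniteDimensional F E] : FiniteDimensional F (CyclicLie τ c) :=
  inferInstanceAs (FiniteDimensional F (∀ i : Fin c, component τ i))

/-- The coordinate at index `k`, which is zero if `c ≤ k`. -/
def coord (k : ℕ) : CyclicLie τ c →ₗ[F] E :=
  if h : k < c then
    (component τ k).subtype ∘ₗ LinearMap.proj (φ := fun i : Fin c => component τ i) ⟨k, h⟩
  else 0

theorem coord_of_lt {k : ℕ} (h : k < c) (x : CyclicLie τ c) : coord k x = (x ⟨k, h⟩ : E) := by
  simp only [coord, dif_pos h]
  rfl

theorem coord_of_le {k : ℕ} (h : c ≤ k) (x : CyclicLie τ c) : coord k x = 0 := by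
  simp [coord, dif_neg h.not_gt]

theorem coord_mem (k : ℕ) (x : CyclicLie τ c) : coord k x ∈ component τ k := by
  by_cases h : k < c
  · rw [coord_of_lt h]
    exact (x ⟨k, h⟩).2
  · rw [coord_of_le (not_lt.mp h)]
    exact zero_mem _

theorem ext_coord {x y : CyclicLie τ c} (h : ∀ k < c, coord k x = coord k y) : x = y := by
  funext i
  apply Subtype.ext
  simpa only [coord_of_lt i.2] using h i i.2

/-- The element with coordinates `v k` for `k < c`. -/
def mk (v : ℕ → E) (hv : ∀ k, v k ∈ component τ k) : CyclicLie τ c := fun i => ⟨v i, hv i⟩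

theorem coord_mk {v : ℕ → E} {hv : ∀ k, v k ∈ component τ k} {k : ℕ} (h : k < c) :
    coord k (mk v hv : CyclicLie τ c) = v k := by
  rw [coord_of_lt h]
  rfl

/-- The element with a single nonzero coordinate `v` at index `i`. -/
def single (i : ℕ) (v : component τ i) : CyclicLie τ c :=
  mk (fun k => if k = i then (v : E) else 0) fun k => by
    by_cases h : k = i
    · subst h
      simp
    · simp [h]

theorem coord_single {i k : ℕ} (h : k < c) (v : component τ i) :
    coord k (single i v : CyclicLie τ c) = if k = i then (v : E) else 0 := coord_mk h

theorem sum_single (x : CyclicLie τ c) :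
    x = ∑ i ∈ Finset.range c, single i ⟨coord i x, coord_mem i x⟩ := by
  refine ext_coord fun k hk => ?_
  simp only [map_sum, coord_single hk]
  simp [hk]

/-- The coordinates of the Lie bracket. -/
def bracketCoord (x y : CyclicLie τ c) : ℕ → E
  | 0 => 0
  | k + 1 => τ (coord 0 x) * coord k y - τ (coord 0 y) * coord k x

variable [hτ : Fact (Function.Involutive τ)]

/-- Only index `1` imposes a condition: `τ` exchanges the two terms of `τ x * y - τ y * x`. Without
the twist by `τ` this expression would vanish. -/
theorem bracketCoord_mem (x y : CyclicLie τ c) (k : ℕ) : bracketCoord x y k ∈ component τ k := by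
  rw [mem_component]
  rintro rfl
  simp only [bracketCoord, map_sub, map_mul, hτ.out _]
  ring

instance : Bracket (CyclicLie τ c) (CyclicLie τ c) where
  bracket x y := mk (bracketCoord x y) (bracketCoord_mem x y)

theorem coord_zero_lie (x y : CyclicLie τ c) : coord 0 ⁅x, y⁆ = 0 := by
  by_cases h : 0 < c
  · exact coord_mk h
  · exact coord_of_le (not_lt.mp h) _

theorem coord_succ_lie {k : ℕ} (h : k + 1 < c) (x y : CyclicLie τ c) :
    coord (k + 1) ⁅x, y⁆ = τ (coord 0 x) * coord k y - τ (coord 0 y) * coord k x :=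
  coord_mk h

/-- The Jacobi identity reduces to commutativity of `E`: a bracket has no coordinate of index `0`,
so it is only acted upon, by commuting multiplications. -/
instance : LieRing (CyclicLie τ c) where
  add_lie x y z := ext_coord fun k hk => by
    cases k with
    | zero => simp [coord_zero_lie]
    | succ k =>
      simp only [coord_succ_lie hk, map_add]
      ring
  lie_add x y z := ext_coord fun k hk => by
    cases k with
    | zero => simp [coord_zero_lie]
    | succ k =>
      simp only [coord_succ_lie hk, map_add]
      ring
  lie_self x := ext_coord fun k hk => by
    cases k with
    | zero => simp [coord_zero_lie]
    | succ k => simp [coord_succ_lie hk]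
  leibniz_lie x y z := ext_coord fun k hk => by
    match k with
    | 0 => simp [coord_zero_lie]
    | 1 => simp [coord_zero_lie, coord_succ_lie hk]
    | k + 2 =>
      simp only [coord_succ_lie hk, coord_succ_lie ((Nat.lt_succ_self _).trans hk), map_add,
        coord_zero_lie, map_zero]
      ring

instance : LieAlgebra F (CyclicLie τ c) where
  lie_smul r x y := ext_coord fun k hk => by
    cases k with
    | zero => simp [coord_zero_lie]
    | succ k =>
      simp only [coord_succ_lie hk, map_smul, smul_sub, mul_smul_comm, smul_mul_assoc]

/-! ### The lower central series -/

section LowerCentralSeries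

variable (τ c) in
/-- The elements whose first `k` coordinates vanish. -/
def filtration (k : ℕ) : LieIdeal F (CyclicLie τ c) where
  carrier := {x | ∀ i < k, coord i x = 0}
  add_mem' {x y} hx hy i hi := by rw [map_add, hx i hi, hy i hi, add_zero]
  zero_mem' i _ := map_zero _
  smul_mem' r x hx i hi := by rw [map_smul, hx i hi, smul_zero]
  lie_mem {x y} hy i hi := by
    by_cases hc : i < c
    · cases i with
      | zero => exact coord_zero_lie _ _
      | succ i => rw [coord_succ_lie hc, hy i (by omega), hy 0 (by omega)]; simp
    · exact coord_of_le (not_lt.mp hc) _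

theorem mem_filtration {k : ℕ} {x : CyclicLie τ c} :
    x ∈ filtration τ c k ↔ ∀ i < k, coord i x = 0 := Iff.rfl

theorem lie_mem_lowerCentralSeries_succ (k : ℕ) (x : CyclicLie τ c) {y : CyclicLie τ c}
    (hy : y ∈ LieModule.lowerCentralSeries F (CyclicLie τ c) (CyclicLie τ c) k) :
    ⁅x, y⁆ ∈ LieModule.lowerCentralSeries F (CyclicLie τ c) (CyclicLie τ c) (k + 1) := by
  rw [LieModule.lowerCentralSeries_succ]
  exact LieSubmodule.lie_mem_lie (LieSubmodule.mem_top x) hy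

theorem single_mem_filtration {i k : ℕ} (h : k ≤ i) (v : component τ i) :
    (single i v : CyclicLie τ c) ∈ filtration τ c k := fun j hj => by
  by_cases hc : j < c
  · rw [coord_single hc, if_neg (by omega)]
  · exact coord_of_le (not_lt.mp hc) _

theorem lie_single_zero_single {i : ℕ} (hi : i ≠ 0) (v : component τ 0)
    (w : component τ i) (u : component τ (i + 1)) (huv : (u : E) = τ v * w) :
    ⁅(single 0 v : CyclicLie τ c), (single i w : CyclicLie τ c)⁆ = single (i + 1) u := by
  refine ext_coord fun k hk => ?_
  cases k with
  | zero => rw [coord_zero_lie, coord_single hk, if_neg (by omega)]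
  | succ k =>
    rw [coord_succ_lie hk, coord_single hk, coord_single (by omega), coord_single (by omega),
      coord_single (by omega), coord_single (by omega), if_pos rfl, if_neg hi.symm, huv]
    by_cases h : k = i
    · simp [h]
    · simp [h]

theorem lie_single_zero_single_zero (v w : component τ 0)
    (u : component τ 1) (huv : (u : E) = τ v * w - τ w * v) :
    ⁅(single 0 v : CyclicLie τ c), (single 0 w : CyclicLie τ c)⁆ = single 1 u := by
  refine ext_coord fun k hk => ?_
  cases k with
  | zero => rw [coord_zero_lie, coord_single hk, if_neg (by omega)]
  | succ k =>
    rw [coord_succ_lie hk, coord_single hk, coord_single (by omega), coord_single (by omega),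
      coord_single (by omega), coord_single (by omega), if_pos rfl, if_pos rfl, huv]
    by_cases h : k = 0
    · simp [h]
    · simp [h]

theorem exists_antiInvariant_ne_zero (h1 : τ ≠ 1) : ∃ d : E, d ≠ 0 ∧ τ d = -d := by
  obtain ⟨a, ha⟩ : ∃ a, τ a ≠ a := by
    by_contra! h
    exact h1 (AlgEquiv.ext h)
  exact ⟨a - τ a, sub_ne_zero.mpr ha.symm, by rw [map_sub, hτ.out a]; ring⟩

/-- A bracket always raises the index. Conversely, every homogeneous element of positive index is a
single bracket of an element of index `0` with one of the preceding index. -/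
theorem lowerCentralSeries_eq_filtration [CharZero E] (h1 : τ ≠ 1) (k : ℕ) :
    LieModule.lowerCentralSeries F (CyclicLie τ c) (CyclicLie τ c) k = filtration τ c k := by
  induction k with
  | zero =>
    rw [LieModule.lowerCentralSeries_zero, eq_comm, eq_top_iff]
    exact fun x _ i hi => absurd hi (Nat.not_lt_zero i)
  | succ k ih =>
    refine le_antisymm ?_ fun x hx => ?_
    · rw [LieModule.lowerCentralSeries_succ, LieSubmodule.lie_le_iff, ih]
      intro x _ y hy i hi
      by_cases hc : i < c
      · cases i with
        | zero => exact coord_zero_lie _ _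
        | succ i =>
          rw [coord_succ_lie hc, hy i (by omega), hy 0 (by omega)]
          simp
      · exact coord_of_le (not_lt.mp hc) _
    · rw [sum_single x]
      refine sum_mem fun i hi => ?_
      rw [Finset.mem_range] at hi
      by_cases hik : i < k + 1
      · convert zero_mem (LieModule.lowerCentralSeries F (CyclicLie τ c) (CyclicLie τ c) (k + 1))
        refine ext_coord fun j hj => ?_
        simp [coord_single hj, hx i hik]
      · have h0 : ∀ v : E, v ∈ component τ 0 := fun v => mem_component.mpr (by simp)
        match i, hi, hik with
        | 0, _, hik => omega
        | 1, hi, hik =>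
          have hanti : τ (coord 1 x) = -coord 1 x := mem_component.mp (coord_mem 1 x) rfl
          -- For `τ u = -u`, the bracket of `-u / 2` with `1` is `u / 2 + u / 2`.
          rw [← lie_single_zero_single_zero ⟨-coord 1 x / 2, h0 _⟩ ⟨1, h0 _⟩
            ⟨coord 1 x, coord_mem 1 x⟩ (by
              simp only [map_div₀, map_neg, hanti, map_one, map_ofNat]
              ring)]
          exact lie_mem_lowerCentralSeries_succ k _
            (by rw [ih]; exact single_mem_filtration (by omega) _)
        | 2, hi, hik =>
          -- Index `1` is not all of `E`, so `1` cannot serve as the acting element. A fixed nonzero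
          -- anti-invariant `d` is multiplied by `coord 2 x / d` instead.
          obtain ⟨d, hd0, hd⟩ := exists_antiInvariant_ne_zero h1
          rw [← lie_single_zero_single one_ne_zero ⟨τ (coord 2 x * d⁻¹), h0 _⟩
            ⟨d, mem_component.mpr fun _ => hd⟩ ⟨coord 2 x, coord_mem 2 x⟩ (by
              simp only [hτ.out _]
              field_simp)]
          exact lie_mem_lowerCentralSeries_succ k _
            (by rw [ih]; exact single_mem_filtration (by omega) _)
        | i + 3, hi, hik =>
          rw [← lie_single_zero_single (by omega : i + 2 ≠ 0) ⟨1, h0 _⟩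
            ⟨coord (i + 3) x, mem_component.mpr (by omega)⟩
            ⟨coord (i + 3) x, coord_mem (i + 3) x⟩ (by simp)]
          exact lie_mem_lowerCentralSeries_succ k _
            (by rw [ih]; exact single_mem_filtration (by omega) _)

end LowerCentralSeries

end CyclicLie

end AnosovLie

/-! ### Characteristic polynomials on the components -/

namespace AnosovLie

open Module Polynomial

section Charpoly

/-- The characteristic polynomial of a block diagonal endomorphism. -/
theorem charpoly_piMap {R : Type*} [Field R] : ∀ {m : ℕ} {M : Fin m → Type*}
    [∀ i, AddCommGroup (M i)] [∀ i, Module R (M i)] [∀ i, FiniteDimensional R (M i)]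
    (f : ∀ i, M i →ₗ[R] M i), (LinearMap.piMap f).charpoly = ∏ i, (f i).charpoly
  | 0, M, _, _, _, f => by
    have h := LinearMap.charpoly_monic (LinearMap.piMap f)
    rw [Fin.prod_univ_zero, ← h.natDegree_eq_zero, LinearMap.charpoly_natDegree]
    exact finrank_zero_of_subsingleton
  | m + 1, M, _, _, _, f => by
    rw [Fin.prod_univ_succ, ← charpoly_piMap (fun i : Fin m => f i.succ),
      ← LinearMap.charpoly_prodMap, ← LinearEquiv.charpoly_conj (Fin.consLinearEquiv R M)]
    congr 1
    refine LinearMap.ext fun x => ?_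
    obtain ⟨y, rfl⟩ := (Fin.consLinearEquiv R M).surjective x
    rw [LinearEquiv.conj_apply_apply, LinearEquiv.symm_apply_apply]
    funext i
    refine Fin.cases ?_ (fun j => ?_) i <;> simp [Fin.consLinearEquiv]

/-- The characteristic polynomial of the multiplication by an element of a Galois extension is the
product over its conjugates. -/
theorem charpoly_lmul_eq_prod {F E : Type*} [Field F] [CharZero F] [Field E] [Algebra F E]
    [FiniteDimensional F E] [IsGalois F E] (a : E) :
    (LinearMap.mulLeft F a).charpoly.map (algebraMap F E) = ∏ g : E ≃ₐ[F] E, (X - C (g a)) := by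
  -- At each of the infinitely many `t` in `F`, both sides take the value of the norm of `t - a`.
  refine eq_of_infinite_eval_eq _ _ ?_
  refine Set.Infinite.mono ?_ (Set.infinite_range_of_injective (algebraMap F E).injective)
  rintro _ ⟨t, rfl⟩
  rw [Set.mem_ofPred_eq, eval_map_apply, LinearMap.eval_charpoly, eval_prod]
  have h : algebraMap F (Module.End F E) t - LinearMap.mulLeft F a =
      LinearMap.mulLeft F (algebraMap F E t - a) := by
    ext x
    simp [sub_mul, Algebra.smul_def]
  rw [h]
  refine (Algebra.norm_eq_prod_automorphisms F (algebraMap F E t - a)).trans ?_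
  simp

end Charpoly

section Components

variable {F E : Type*} [Field F] [Field E] [Algebra F E] {τ : E ≃ₐ[F] E}

/-- Multiplication by `a`, restricted to a component which it preserves. -/
def componentMul (τ : E ≃ₐ[F] E) (i : ℕ) (a : E) (ha : i = 1 → τ a = a) :
    component τ i →ₗ[F] component τ i :=
  (LinearMap.mulLeft F a).restrict fun x hx => mem_component.mpr fun hi => by
    rw [LinearMap.mulLeft_apply, map_mul, ha hi, mem_component.mp hx hi, mul_neg]

/-- A component of index different from `1` is everything. -/
def componentEquiv (τ : E ≃ₐ[F] E) {i : ℕ} (hi : i ≠ 1) : component τ i ≃ₗ[F] E :=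
  LinearEquiv.ofTop _ (if_neg hi)

/-- Splitting of `E` into two copies of the part where the involution acts as `-1`. -/
noncomputable def antiInvariantsEquiv [CharZero E] (hτ : Function.Involutive τ) {d : E}
    (hd0 : d ≠ 0) (hd : τ d = -d) : E ≃ₗ[F] component τ 1 × component τ 1 :=
  LinearEquiv.ofBijective
    (((LinearMap.id - τ.toLinearMap).codRestrict (component τ 1) fun x =>
      mem_component.mpr fun _ => by simp [hτ x]).prod
    ((LinearMap.mulLeft F d ∘ₗ (LinearMap.id + τ.toLinearMap)).codRestrict (component τ 1)
      fun x => mem_component.mpr fun _ => by simp [hτ x, hd, add_comm])) (by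
    constructor
    · rw [← LinearMap.ker_eq_bot, LinearMap.ker_eq_bot']
      intro x hx
      have h1 : x - τ x = 0 := congrArg (fun y => (y.1 : E)) hx
      have h2 : d * (x + τ x) = 0 := congrArg (fun y => (y.2 : E)) hx
      have h3 := (mul_eq_zero.mp h2).resolve_left hd0
      have h4 : 2 * x = 0 := by linear_combination h1 + h3
      exact (mul_eq_zero.mp h4).resolve_left two_ne_zero
    · rintro ⟨u, v⟩
      have hu := mem_component.mp u.2 rfl
      have hv := mem_component.mp v.2 rfl
      refine ⟨(u + v / d) / 2, Prod.ext (Subtype.ext ?_) (Subtype.ext ?_)⟩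
      · change (u + v / d) / 2 - τ ((u + v / d) / 2) = (u : E)
        simp only [map_div₀, map_add, hu, hv, hd, map_ofNat]
        field_simp
        ring
      · change d * ((u + v / d) / 2 + τ ((u + v / d) / 2)) = (v : E)
        simp only [map_div₀, map_add, hu, hv, hd, map_ofNat]
        field_simp
        ring)

/-- Multiplication by a `τ`-fixed `a` commutes with `x ↦ x - τ x` and `x ↦ d * (x + τ x)`. On `E` it
is therefore two copies of its restriction to index `1`. -/
theorem antiInvariantsEquiv_mul [CharZero E] (hτ : Function.Involutive τ) {d : E}
    (hd0 : d ≠ 0) (hd : τ d = -d) {a : E} (ha : τ a = a) :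
    (antiInvariantsEquiv hτ hd0 hd).conj (LinearMap.mulLeft F a) =
      (componentMul τ 1 a fun _ => ha).prodMap (componentMul τ 1 a fun _ => ha) := by
  refine LinearMap.ext fun x => ?_
  obtain ⟨y, rfl⟩ := (antiInvariantsEquiv hτ hd0 hd).surjective x
  rw [LinearEquiv.conj_apply_apply, LinearEquiv.symm_apply_apply]
  refine Prod.ext (Subtype.ext ?_) (Subtype.ext ?_)
  · change a * y - τ (a * y) = a * (y - τ y)
    rw [map_mul, ha]
    ring
  · change d * (a * y + τ (a * y)) = a * (d * (y + τ y))
    rw [map_mul, ha]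
    ring

theorem finrank_component_of_ne {i : ℕ} (hi : i ≠ 1) :
    finrank F (component τ i) = finrank F E :=
  (componentEquiv τ hi).finrank_eq

theorem two_mul_finrank_component_one [CharZero E] [FiniteDimensional F E]
    [hτ : Fact (Function.Involutive τ)] (h1 : τ ≠ 1) :
    2 * finrank F (component τ 1) = finrank F E := by
  obtain ⟨d, hd0, hd⟩ := CyclicLie.exists_antiInvariant_ne_zero h1
  rw [(antiInvariantsEquiv hτ.out hd0 hd).finrank_eq, finrank_prod, two_mul]

theorem charpoly_componentMul_of_ne [FiniteDimensional F E] {i : ℕ} (hi : i ≠ 1) (a : E)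
    (ha : i = 1 → τ a = a) :
    (componentMul τ i a ha).charpoly = (LinearMap.mulLeft F a).charpoly := by
  rw [← LinearEquiv.charpoly_conj (componentEquiv τ hi)]
  congr 1

theorem charpoly_componentMul_one_sq [CharZero E] [FiniteDimensional F E]
    [hτ : Fact (Function.Involutive τ)] (h1 : τ ≠ 1) {a : E} (ha : τ a = a) :
    (componentMul τ 1 a fun _ => ha).charpoly ^ 2 = (LinearMap.mulLeft F a).charpoly := by
  obtain ⟨d, hd0, hd⟩ := CyclicLie.exists_antiInvariant_ne_zero h1
  rw [← LinearEquiv.charpoly_conj (antiInvariantsEquiv hτ.out hd0 hd),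
    antiInvariantsEquiv_mul hτ.out hd0 hd ha, LinearMap.charpoly_prodMap, sq]

end Components

/-! ### The scaling automorphism -/

namespace CyclicLie

section Scaling

variable {F E : Type*} [Field F] [Field E] [Algebra F E] {τ : E ≃ₐ[F] E} {c : ℕ}
  [hτ : Fact (Function.Involutive τ)]

omit hτ in
theorem weight_mem (hτ' : Function.Involutive τ) (a : E) (i : ℕ) (hi : i = 1) :
    τ (a ^ i * τ a) = a ^ i * τ a := by
  subst hi
  rw [pow_one, map_mul, hτ' a, mul_comm]

/-- The linear map acting on the component of index `i` as multiplication by `a ^ i * τ a`. -/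
def scaleLinear (a : E) : CyclicLie τ c →ₗ[F] CyclicLie τ c :=
  LinearMap.piMap fun i : Fin c => componentMul τ i (a ^ (i : ℕ) * τ a) (weight_mem hτ.out a i)

theorem coord_scaleLinear (k : ℕ) (a : E) (x : CyclicLie τ c) :
    coord k (scaleLinear a x) = a ^ k * τ a * coord k x := by
  by_cases h : k < c
  · rw [coord_of_lt h, coord_of_lt h]
    rfl
  · rw [coord_of_le (not_lt.mp h), coord_of_le (not_lt.mp h), mul_zero]

theorem scaleLinear_lie (a : E) (x y : CyclicLie τ c) :
    scaleLinear a ⁅x, y⁆ = ⁅scaleLinear a x, scaleLinear a y⁆ := by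
  refine ext_coord fun k hk => ?_
  rw [coord_scaleLinear]
  cases k with
  | zero => rw [coord_zero_lie, coord_zero_lie, mul_zero]
  | succ k =>
    simp only [coord_succ_lie hk, coord_scaleLinear, pow_zero, one_mul, map_mul, hτ.out a]
    ring

theorem scaleLinear_scaleLinear_of_mul_eq_one {a b : E} (h : a * b = 1) (x : CyclicLie τ c) :
    scaleLinear a (scaleLinear b x) = x := by
  refine ext_coord fun k _ => ?_
  have h' : τ a * τ b = 1 := by rw [← map_mul, h, map_one]
  have hk : a ^ k * b ^ k = 1 := by rw [← mul_pow, h, one_pow]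
  rw [coord_scaleLinear, coord_scaleLinear]
  linear_combination (τ a * τ b * coord k x) * hk + coord k x * h'

/-- The automorphism acting on the component of index `i` as multiplication by `a ^ i * τ a`. -/
def scaleEquiv (a : E) (ha : a ≠ 0) : CyclicLie τ c ≃ₗ⁅F⁆ CyclicLie τ c :=
  { scaleLinear a with
    map_lie' := scaleLinear_lie a _ _
    invFun := scaleLinear a⁻¹
    left_inv := scaleLinear_scaleLinear_of_mul_eq_one (inv_mul_cancel₀ ha)
    right_inv := scaleLinear_scaleLinear_of_mul_eq_one (mul_inv_cancel₀ ha) }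

theorem charpoly_scaleEquiv [FiniteDimensional F E] (a : E) (ha : a ≠ 0) :
    ((scaleEquiv a ha : CyclicLie τ c ≃ₗ⁅F⁆ CyclicLie τ c).toLinearEquiv.toLinearMap).charpoly =
      ∏ i : Fin c, (componentMul τ i (a ^ (i : ℕ) * τ a) (weight_mem hτ.out a i)).charpoly :=
  charpoly_piMap fun i : Fin c => componentMul τ i (a ^ (i : ℕ) * τ a) (weight_mem hτ.out a i)

end Scaling

/-! ### Nilpotency class and type -/

section NilpotencyType

variable {E : Type*} [Field E] [Algebra ℚ E] {τ : E ≃ₐ[ℚ] E} {c : ℕ}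
  [hτ : Fact (Function.Involutive τ)]

theorem filtration_eq_bot : filtration τ c c = ⊥ := by
  rw [eq_bot_iff]
  intro x hx
  rw [LieSubmodule.mem_bot]
  exact ext_coord fun k hk => by rw [hx k hk, map_zero]

theorem component_ne_bot (h1 : τ ≠ 1) (i : ℕ) : ∃ v : component τ i, v ≠ 0 := by
  obtain ⟨d, hd0, hd⟩ := exists_antiInvariant_ne_zero h1
  exact ⟨⟨d, mem_component.mpr fun _ => hd⟩, fun h => hd0 (congrArg Subtype.val h)⟩

theorem nilpotencyLength_eq [CharZero E] (h1 : τ ≠ 1) (hc : 1 ≤ c) :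
    LieModule.nilpotencyLength (CyclicLie τ c) (CyclicLie τ c) = c := by
  obtain ⟨m, rfl⟩ : ∃ m, c = m + 1 := ⟨c - 1, by omega⟩
  rw [LieModule.nilpotencyLength_eq_succ_iff ℚ, lowerCentralSeries_eq_filtration h1,
    lowerCentralSeries_eq_filtration h1]
  refine ⟨filtration_eq_bot, fun h => ?_⟩
  obtain ⟨v, hv⟩ := component_ne_bot h1 m
  have hmem := single_mem_filtration (c := m + 1) le_rfl v
  rw [h, LieSubmodule.mem_bot] at hmem
  have := congrArg (coord m) hmem
  rw [coord_single (Nat.lt_succ_self m), if_pos rfl, map_zero] at this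
  exact hv (Subtype.ext this)

theorem hasNilpotencyClass [CharZero E] (h1 : τ ≠ 1) (hc : 1 ≤ c) : HasNilpotencyClass (CyclicLie τ c) c := by
  refine ⟨?_, nilpotencyLength_eq h1 hc⟩
  refine (LieModule.isNilpotent_iff ℚ _ _).mpr ⟨c, ?_⟩
  rw [lowerCentralSeries_eq_filtration h1, filtration_eq_bot]

theorem typeEntry_eq [CharZero E] [FiniteDimensional ℚ E] (h1 : τ ≠ 1) {k : ℕ} (hk : k < c) :
    typeEntry (CyclicLie τ c) (k + 1) = finrank ℚ (component τ k) := by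
  have hg : ∀ j, gamma (CyclicLie τ c) (j + 1) = (filtration τ c j).toSubmodule := fun j => by
    rw [gamma, Nat.add_sub_cancel, lowerCentralSeries_eq_filtration h1]
  let p : gamma (CyclicLie τ c) (k + 1) →ₗ[ℚ] component τ k :=
    ((coord k).codRestrict (component τ k) (coord_mem k)) ∘ₗ Submodule.subtype _
  have hker : LinearMap.ker p =
      (gamma (CyclicLie τ c) (k + 1 + 1)).submoduleOf (gamma (CyclicLie τ c) (k + 1)) := by
    ext x
    rw [LinearMap.mem_ker, Submodule.submoduleOf, Submodule.mem_comap, Submodule.subtype_apply,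
      hg (k + 1), LieSubmodule.mem_toSubmodule,
      mem_filtration]
    have hx : (x : CyclicLie τ c) ∈ filtration τ c k := (hg k).le x.2
    constructor
    · intro h i hi
      rcases Nat.lt_succ_iff_lt_or_eq.mp hi with h' | rfl
      · exact hx i h'
      · exact congrArg Subtype.val h
    · exact fun h => Subtype.ext (h k (Nat.lt_succ_self k))
  have hsurj : Function.Surjective p := fun v => by
    refine ⟨⟨single k v, ?_⟩, Subtype.ext ?_⟩
    · rw [hg k]
      exact single_mem_filtration le_rfl v
    · change coord k (single k v : CyclicLie τ c) = _
      rw [coord_single hk, if_pos rfl]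
  rw [typeEntry, ← hker]
  exact (p.quotKerEquivOfSurjective hsurj).finrank_eq

theorem finrank_component_eq_minimalTypeEntry [CharZero E] [FiniteDimensional ℚ E] (h1 : τ ≠ 1) {n : ℕ}
    (hn : finrank ℚ E = 2 * n) (k : ℕ) :
    finrank ℚ (component τ k) = minimalTypeEntry n (k + 1) := by
  unfold minimalTypeEntry
  by_cases hk : k = 1
  · subst hk
    have := two_mul_finrank_component_one h1
    rw [if_pos rfl]
    omega
  · rw [if_neg (by omega), finrank_component_of_ne hk, hn]

theorem lieType_eq [CharZero E] [FiniteDimensional ℚ E] (h1 : τ ≠ 1) {n : ℕ} (hn : finrank ℚ E = 2 * n)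
    (hc : 1 ≤ c) :
    lieType (CyclicLie τ c) = List.ofFn fun k : Fin c => minimalTypeEntry n (k + 1) := by
  have hlen := nilpotencyLength_eq h1 hc
  refine List.ext_getElem (by simp [lieType, hlen]) fun k hk _ => ?_
  have hk' : k < c := by simpa [lieType, hlen] using hk
  simp [lieType, typeEntry_eq h1 hk', finrank_component_eq_minimalTypeEntry h1 hn]

end NilpotencyType

end CyclicLie

end AnosovLie

/-! ### Factorization into conjugates -/

namespace AnosovLie

open Module Polynomial

theorem minimalTypeEntry_of_ne {n j : ℕ} (hj : j ≠ 2) : minimalTypeEntry n j = 2 * n := if_neg hj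

section CharpolyFactorization

variable {E : Type*} [Field E] [Algebra ℚ E] [FiniteDimensional ℚ E] [IsGalois ℚ E]

theorem prod_Icc_two_mul {M : Type*} [CommMonoid M] (n : ℕ) (F : ℕ → M) :
    ∏ i ∈ Finset.Icc 1 (2 * n), F i =
      (∏ i ∈ Finset.Icc 1 n, F i) * ∏ i ∈ Finset.Icc 1 n, F (i + n) := by
  have h : ∀ m, Finset.Icc 1 m = Finset.Ico 1 (m + 1) := fun m => by
    ext
    simp
  rw [h, h, Finset.prod_Ico_add', ← Finset.prod_Ico_consecutive F (show 1 ≤ n + 1 by omega)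
    (show n + 1 ≤ 2 * n + 1 by omega)]
  congr 2
  ring_nf

theorem charpoly_lmul_eq_prod_pow {σ : E ≃ₐ[ℚ] E} {N : ℕ} (hN : finrank ℚ E = N)
    (hσ : ∀ τ : E ≃ₐ[ℚ] E, τ ∈ Subgroup.zpowers σ) (a : E) :
    (LinearMap.mulLeft ℚ a).charpoly.map (algebraMap ℚ E) =
      ∏ i ∈ Finset.Icc 1 N, (X - C ((σ ^ i) a)) := by
  rw [charpoly_lmul_eq_prod]
  refine (prod_pow_generator ?_ hσ fun g : E ≃ₐ[ℚ] E => (X - C (g a))).symm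
  rw [IsGalois.card_aut_eq_finrank, hN]

/-- Since `σ ^ n` fixes `a`, the product over all `2n` conjugates is the square of the product over
the first `n`. Square roots agree up to sign, and both sides are monic. -/
theorem charpoly_componentMul_one {σ : E ≃ₐ[ℚ] E} {n : ℕ} (hE : finrank ℚ E = 2 * n)
    (hσ : ∀ τ : E ≃ₐ[ℚ] E, τ ∈ Subgroup.zpowers σ) [Fact (Function.Involutive (σ ^ n))]
    (h1 : σ ^ n ≠ 1) {a : E} (ha : (σ ^ n) a = a) :
    (componentMul (σ ^ n) 1 a fun _ => ha).charpoly.map (algebraMap ℚ E) =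
      ∏ i ∈ Finset.Icc 1 n, (X - C ((σ ^ i) a)) := by
  have : CharZero E := algebraRat.charZero E
  have hsq := congrArg (Polynomial.map (algebraMap ℚ E)) (charpoly_componentMul_one_sq h1 ha)
  rw [Polynomial.map_pow, charpoly_lmul_eq_prod_pow hE hσ, prod_Icc_two_mul] at hsq
  simp only [pow_add, AlgEquiv.mul_apply, ha] at hsq
  rw [← sq, sq_eq_sq_iff_eq_or_eq_neg] at hsq
  refine hsq.resolve_right fun h => ?_
  have h2 := congrArg leadingCoeff h
  rw [leadingCoeff_neg, ((LinearMap.charpoly_monic _).map _).leadingCoeff,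
    (monic_prod_of_monic _ _ fun i _ => monic_X_sub_C _).leadingCoeff] at h2
  exact neg_ne_self.mpr one_ne_zero h2.symm

theorem charpoly_scaleEquiv_map {σ : E ≃ₐ[ℚ] E} {n c : ℕ} (hE : finrank ℚ E = 2 * n)
    (hσ : ∀ τ : E ≃ₐ[ℚ] E, τ ∈ Subgroup.zpowers σ) [Fact (Function.Involutive (σ ^ n))]
    (h1 : σ ^ n ≠ 1) (a : E) (ha : a ≠ 0) :
    (toEndo (CyclicLie.scaleEquiv a ha :
      CyclicLie (σ ^ n) c ≃ₗ⁅ℚ⁆ CyclicLie (σ ^ n) c)).charpoly.map (algebraMap ℚ E) =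
      ∏ j ∈ Finset.Icc 1 c, ∏ i ∈ Finset.Icc 1 (minimalTypeEntry n j),
        (X - C (((σ ^ i) a) ^ (j - 1) * (σ ^ (i + n)) a)) := by
  have hval : ∀ i k : ℕ, (σ ^ i) (a ^ k * (σ ^ n) a) = ((σ ^ i) a) ^ k * (σ ^ (i + n)) a :=
    fun i k => by rw [map_mul, map_pow, pow_add, AlgEquiv.mul_apply]
  have hIcc : Finset.Icc 1 c = Finset.Ico (0 + 1) (c + 1) := by
    ext
    simp
  rw [toEndo, CyclicLie.charpoly_scaleEquiv, Polynomial.map_prod, hIcc,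
    ← Finset.prod_Ico_add' _ 0 c 1, ← Finset.range_eq_Ico, Finset.prod_range]
  refine Finset.prod_congr rfl fun k _ => ?_
  rw [Nat.add_sub_cancel]
  simp only [← hval]
  obtain ⟨k, hk⟩ := k
  by_cases hk1 : k = 1
  · subst hk1
    exact charpoly_componentMul_one hE hσ h1 (CyclicLie.weight_mem Fact.out a 1 rfl)
  · rw [minimalTypeEntry_of_ne (by simpa using hk1), ← charpoly_lmul_eq_prod_pow hE hσ,
      ← charpoly_componentMul_of_ne hk1]

end CharpolyFactorization

/-! ### From eigenvalues to the Anosov property and the signature -/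

section Eigenvalues

variable {L : Type*} [LieRing L] [LieAlgebra ℚ L] [FiniteDimensional ℚ L]

/-- The coefficients are rational algebraic integers, hence integers. The constant one, which is the
determinant up to sign, has an inverse that is integral for the same reason. -/
theorem isIntegerLike_of_charpoly_eq_prod {E ι : Type*} [Field E] [Algebra ℚ E] {f : L ≃ₗ⁅ℚ⁆ L}
    {s : Finset ι} {v : ι → E}
    (hf : (toEndo f).charpoly.map (algebraMap ℚ E) = ∏ p ∈ s, (X - C (v p)))
    (hv : ∀ p, IsIntegral ℤ (v p)) (hv' : ∀ p, IsIntegral ℤ (v p)⁻¹) : IsIntegerLike f := by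
  have hinj := (algebraMap ℚ E).injective
  have hint : ∀ {q : ℚ}, IsIntegral ℤ (algebraMap ℚ E q) → ∃ a : ℤ, q = a := fun {q} hq => by
    obtain ⟨a, ha⟩ := IsIntegrallyClosed.isIntegral_iff.mp ((isIntegral_algebraMap_iff hinj).mp hq)
    exact ⟨a, ha.symm⟩
  have hcoeff : ∀ k, ∃ a : ℤ, (toEndo f).charpoly.coeff k = a := fun k => by
    refine hint ?_
    rw [← coeff_map, hf]
    have hmem : ∏ p ∈ s, (X - C (v p)) ∈ liftsRing (algebraMap (integralClosure ℤ E) E) := by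
      refine prod_mem fun p _ => (lifts_iff_liftsRing _ _).mp ?_
      exact ⟨X - C ⟨v p, hv p⟩, by simp⟩
    obtain ⟨q, hq⟩ := (lifts_iff_coeff_lifts _).mp ((lifts_iff_liftsRing _ _).mpr hmem) k
    rw [← hq]
    exact q.2
  refine ⟨hcoeff, ?_⟩
  have h0 : algebraMap ℚ E ((toEndo f).charpoly.coeff 0) = ∏ p ∈ s, -v p := by
    rw [← coeff_map, hf, coeff_zero_eq_eval_zero, eval_prod]
    simp
  obtain ⟨a, ha⟩ := hcoeff 0
  obtain ⟨b, hb⟩ : ∃ b : ℤ, ((toEndo f).charpoly.coeff 0)⁻¹ = b := by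
    refine hint ?_
    rw [map_inv₀, h0, ← Finset.prod_inv_distrib]
    exact IsIntegral.prod _ fun p _ => by
      rw [inv_neg]
      exact (hv' p).neg
  have hne : (toEndo f).charpoly.coeff 0 ≠ 0 := fun h => by
    have hdet := LinearMap.det_eq_sign_charpoly_coeff (toEndo f)
    rw [h, mul_zero] at hdet
    exact (LinearEquiv.isUnit_det' f.toLinearEquiv).ne_zero hdet
  have hab : a * b = 1 := by
    have := mul_inv_cancel₀ hne
    rw [hb, ha] at this
    exact_mod_cast this
  rw [LinearMap.det_eq_sign_charpoly_coeff, abs_mul, abs_pow, abs_neg, abs_one, one_pow, one_mul,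
    ha]
  exact_mod_cast Int.isUnit_iff_abs_eq.mp (IsUnit.of_mul_eq_one _ hab)

theorem eigenvalues_eq_of_charpoly_eq_prod {E : IntermediateField ℚ ℝ} {ι : Type*} {f : L ≃ₗ⁅ℚ⁆ L}
    {s : Finset ι} {v : ι → E}
    (hf : (toEndo f).charpoly.map (algebraMap ℚ E) = ∏ p ∈ s, (X - C (v p))) :
    eigenvalues f = s.val.map fun p => (((v p : E) : ℝ) : ℂ) := by
  have hcomp : algebraMap ℚ ℂ =
      (Complex.ofRealHom.comp (algebraMap E ℝ)).comp (algebraMap ℚ E) := Subsingleton.elim _ _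
  have hprod : (toEndo f).charpoly.map (algebraMap ℚ ℂ) =
      ((s.val.map fun p => (((v p : E) : ℝ) : ℂ)).map fun z => X - C z).prod := by
    rw [hcomp, ← Polynomial.map_map, hf, Polynomial.map_prod, Multiset.map_map]
    refine Finset.prod_congr rfl fun p _ => ?_
    rw [Polynomial.map_sub, map_X, map_C]
    rfl
  rw [eigenvalues, aroots_def, hprod, roots_multiset_prod_X_sub_C]

theorem card_filter_sigma {c : ℕ} {m : ℕ → ℕ} (P : ℕ → ℕ → Prop) [∀ j i, Decidable (P j i)] :
    (((Finset.Icc 1 c).sigma fun j => Finset.Icc 1 (m j)).filter fun p => P p.1 p.2).card =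
      ∑ j ∈ Finset.Icc 1 c, ((Finset.Icc 1 (m j)).filter fun i => P j i).card := by
  simp only [Finset.card_filter]
  rw [Finset.sum_sigma]

/-- If the eigenvalues are arranged in `c` rows of length at least two, each containing exactly one
eigenvalue of absolute value `> 1` and otherwise only eigenvalues of absolute value `< 1`, then the
automorphism is hyperbolic and the minimum of its signature is `c`. -/
theorem isHyperbolic_and_isLeast_signature {E : IntermediateField ℚ ℝ} {f : L ≃ₗ⁅ℚ⁆ L} {c : ℕ}
    {m r : ℕ → ℕ} {v : ℕ → ℕ → E}
    (hf : (toEndo f).charpoly.map (algebraMap ℚ E) =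
      ∏ j ∈ Finset.Icc 1 c, ∏ i ∈ Finset.Icc 1 (m j), (X - C (v j i)))
    (hm : ∀ j ∈ Finset.Icc 1 c, 2 ≤ m j) (hr : ∀ j ∈ Finset.Icc 1 c, r j ∈ Finset.Icc 1 (m j))
    (hbig : ∀ j ∈ Finset.Icc 1 c, 1 < |((v j (r j) : E) : ℝ)|)
    (hsmall : ∀ j ∈ Finset.Icc 1 c, ∀ i ∈ Finset.Icc 1 (m j), i ≠ r j →
      |((v j i : E) : ℝ)| < 1) :
    IsHyperbolic f ∧ IsLeast (signature f) c := by
  rw [Finset.prod_sigma'] at hf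
  have hev := eigenvalues_eq_of_charpoly_eq_prod hf
  have hunstable : unstableDim f = c := by
    have h1 : unstableDim f = (((Finset.Icc 1 c).sigma fun j => Finset.Icc 1 (m j)).filter
        fun p => 1 < |((v p.1 p.2 : E) : ℝ)|).card := by
      rw [unstableDim, hev, Multiset.map_map, Multiset.countP_map]
      simp only [Function.comp_apply, Complex.norm_real, Real.norm_eq_abs]
      rfl
    rw [h1, card_filter_sigma fun j i => 1 < |((v j i : E) : ℝ)|]
    have h2 : ∀ j ∈ Finset.Icc 1 c,
        ((Finset.Icc 1 (m j)).filter fun i => 1 < |((v j i : E) : ℝ)|).card = 1 := fun j hj => by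
      rw [Finset.card_eq_one]
      refine ⟨r j, Finset.ext fun i => ?_⟩
      rw [Finset.mem_filter, Finset.mem_singleton]
      constructor
      · rintro ⟨hi, h⟩
        by_contra hne
        exact (hsmall j hj i hi hne).not_gt h
      · rintro rfl
        exact ⟨hr j hj, hbig j hj⟩
    rw [Finset.sum_congr rfl h2]
    simp
  -- A row of length at least two also contains a contracting eigenvalue, so the stable dimension
  -- cannot fall below `c`.
  have hstable : c ≤ stableDim f := by
    have h1 : stableDim f = (((Finset.Icc 1 c).sigma fun j => Finset.Icc 1 (m j)).filter
        fun p => |((v p.1 p.2 : E) : ℝ)| < 1).card := by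
      rw [stableDim, hev, Multiset.map_map, Multiset.countP_map]
      simp only [Function.comp_apply, Complex.norm_real, Real.norm_eq_abs]
      rfl
    rw [h1, card_filter_sigma fun j i => |((v j i : E) : ℝ)| < 1]
    calc c = ∑ j ∈ Finset.Icc 1 c, 1 := by simp
      _ ≤ _ := Finset.sum_le_sum fun j hj => Finset.card_pos.mpr ?_
    obtain ⟨i, hi, hne⟩ : ∃ i ∈ Finset.Icc 1 (m j), i ≠ r j := by
      have := hm j hj
      by_cases h : r j = 1
      · exact ⟨2, by simp [this], by omega⟩
      · exact ⟨1, by simp; omega, by omega⟩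
    exact ⟨i, Finset.mem_filter.mpr ⟨hi, hsmall j hj i hi hne⟩⟩
  refine ⟨fun z hz => ?_, Or.inr hunstable.symm, ?_⟩
  · rw [hev, Multiset.mem_map] at hz
    obtain ⟨⟨j, i⟩, hp, rfl⟩ := hz
    obtain ⟨hj, hi⟩ := Finset.mem_sigma.mp (Finset.mem_val.mp hp)
    rw [Complex.norm_real, Real.norm_eq_abs]
    by_cases h : i = r j
    · subst h
      exact (hbig j hj).ne'
    · exact (hsmall j hj i hi h).ne
  · rintro k (rfl | rfl)
    · exact hstable
    · exact hunstable.ge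

end Eigenvalues

/-! ### Absolute values of the eigenvalues -/

/-- The position of the eigenvalue of absolute value `> 1` in row `j`. -/
def expandingIndex (n j : ℕ) : ℕ := if j ≤ 2 then n else 2 * n

theorem expandingIndex_mem {n j : ℕ} (hn : 2 ≤ n) :
    expandingIndex n j ∈ Finset.Icc 1 (minimalTypeEntry n j) := by
  unfold expandingIndex minimalTypeEntry
  rw [Finset.mem_Icc]
  split_ifs <;> omega

theorem two_le_minimalTypeEntry {n : ℕ} (hn : 2 ≤ n) (j : ℕ) : 2 ≤ minimalTypeEntry n j := by
  unfold minimalTypeEntry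
  split_ifs <;> omega

section Growth

variable {n : ℕ} {A : ℕ → ℝ} (hper : ∀ k, A (k + 2 * n) = A k) (hpos : ∀ k, 0 < A k)
  (hlt : ∀ k, ¬ 2 * n ∣ k → A k < 1) (h0 : 1 < A 0)

-- Here `A k` stands for `|σ ^ k λ|`. The expanding value is `A 0` for `j = 1` and `A 0 ^ (j - 1) *
-- A n` for `j ≥ 2`, which is at least `A 0 * A n`.
include hper hpos h0 in
theorem one_lt_expanding (hlow : 1 < A 0 * A n) {j : ℕ} (hj : 1 ≤ j) :
    1 < A (expandingIndex n j) ^ (j - 1) * A (expandingIndex n j + n) := by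
  have h2n : A (n + n) = A 0 := by rw [← hper 0, zero_add, two_mul]
  rcases (by omega : j = 1 ∨ j = 2 ∨ 3 ≤ j) with rfl | rfl | h
  · simpa [expandingIndex, h2n] using h0
  · simpa [expandingIndex, h2n, mul_comm] using hlow
  · have h2n' : A (2 * n) = A 0 := by rw [two_mul, h2n]
    have h3n : A (2 * n + n) = A n := by rw [add_comm, hper]
    rw [expandingIndex, if_neg (by omega), h2n', h3n]
    exact hlow.trans_le (mul_le_mul_of_nonneg_right
      (le_self_pow₀ h0.le (by omega)) (hpos n).le)

-- The only dangerous index left is `i = n` with `j ≥ 3`, where the value `A n ^ (j - 1) * A 0` is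
-- at most `A 0 * A n ^ 2`. The other index involving `A 0`, namely `i = 2 * n`, is expanding for `j
-- ≥ 3`, out of range for `j = 2`, and harmless for `j = 1`, where the exponent is zero.
include hper hpos hlt in
theorem contracting_lt_one (hn : 2 ≤ n) (hhigh : A 0 * A n ^ 2 < 1) {i j : ℕ} (hj : 1 ≤ j)
    (hi : i ∈ Finset.Icc 1 (minimalTypeEntry n j)) (hij : i ≠ expandingIndex n j) :
    A i ^ (j - 1) * A (i + n) < 1 := by
  have h2n : A (n + n) = A 0 := by rw [← hper 0, zero_add, two_mul]
  have hmul : ∀ k, 0 < k → k < 4 * n → k ≠ 2 * n → A k < 1 := fun k hk hk4 hk2 => hlt k <| by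
    rintro ⟨q, rfl⟩
    rcases (by omega : q = 0 ∨ q = 1 ∨ 2 ≤ q) with rfl | rfl | hq
    · simp at hk
    · simp at hk2
    · nlinarith
  rw [Finset.mem_Icc] at hi
  obtain ⟨hi1, hi2⟩ := hi
  unfold expandingIndex at hij
  unfold minimalTypeEntry at hi2
  by_cases hin : i = n
  · subst hin
    have hj3 : 3 ≤ j := by
      by_contra h
      exact hij (if_pos (by omega)).symm
    rw [h2n, mul_comm]
    refine lt_of_le_of_lt (mul_le_mul_of_nonneg_left ?_ (hpos 0).le) hhigh
    exact pow_le_pow_of_le_one (hpos i).le (hmul i (by omega) (by omega) (by omega)).le (by omega)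
  · have hin2 : i ≤ 2 * n := by split_ifs at hi2 <;> omega
    have hB : A (i + n) < 1 := hmul _ (by omega) (by omega) (by omega)
    rcases (by omega : j = 1 ∨ 2 ≤ j) with rfl | hj2
    · simpa using hB
    · have hi2n : i ≠ 2 * n := by split_ifs at hi2 hij <;> omega
      exact mul_lt_one_of_nonneg_of_lt_one_right (pow_le_one₀ (hpos i).le
        (hmul i (by omega) (by omega) hi2n).le) (hpos _).le hB

end Growth

end AnosovLie

/-! ### The main theorem -/

theorem mainTheorem3 (c n : ℕ) (hc : 1 ≤ c) (hn : 2 ≤ n) :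
    ∃ (E : IntermediateField ℚ ℝ) (σ : E ≃ₐ[ℚ] E) (lam : E)
      (L : Type) (_ : LieRing L) (_ : LieAlgebra ℚ L) (_ : FiniteDimensional ℚ L)
      (f : L ≃ₗ⁅ℚ⁆ L),
      (Module.finrank ℚ E = 2 * n ∧ IsGalois ℚ E ∧ (∀ τ : E ≃ₐ[ℚ] E, τ ∈ Subgroup.zpowers σ)) ∧
      AnosovLie.IsUnitPisot E lam ∧
      AnosovLie.HasNilpotencyClass L c ∧
      AnosovLie.lieType L =
        List.ofFn (fun k : Fin c => AnosovLie.minimalTypeEntry n (k + 1)) ∧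
      AnosovLie.IsAnosov f ∧
      IsLeast (AnosovLie.signature f) c ∧
      (AnosovLie.toEndo f).charpoly.map (algebraMap ℚ E) =
        ∏ j ∈ Finset.Icc 1 c, ∏ i ∈ Finset.Icc 1 (AnosovLie.minimalTypeEntry n j),
          (Polynomial.X - Polynomial.C (((σ ^ i) lam) ^ (j - 1) * (σ ^ (i + n)) lam)) := by
  obtain ⟨E, hE, hGal, hcyc⟩ := AnosovLie.exists_real_cyclic_extension (2 * n) (by omega)
  have hfin : FiniteDimensional ℚ E := Module.finite_of_finrank_pos (by omega)
  obtain ⟨σ, hσ⟩ := hcyc.exists_generator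
  have hord : orderOf σ = 2 * n :=
    AnosovLie.orderOf_eq_of_generates (by rw [IsGalois.card_aut_eq_finrank, hE]) hσ
  have h1 : σ ^ n ≠ 1 := fun h => by
    have := Nat.le_of_dvd (by omega) (orderOf_dvd_of_pow_eq_one h)
    omega
  have hpow : σ ^ (2 * n) = 1 := by rw [← hord, pow_orderOf_eq_one]
  have hinv : Fact (Function.Involutive (σ ^ n)) := ⟨fun x => by
    rw [← AlgEquiv.mul_apply, ← pow_add, ← two_mul, hpow, AlgEquiv.one_apply]⟩
  -- The controlled conjugate is the image under the involution; the degree `2 * n` is at least `3`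
  -- because `n ≥ 2`.
  obtain ⟨lam, hlam, hlow, hhigh⟩ := AnosovLie.exists_unitPisot (by omega) (σ ^ n) h1
  obtain ⟨hint, hint', hone, hconj⟩ := id hlam
  have hlam0 : lam ≠ 0 := fun h => by
    rw [h] at hone
    norm_num at hone
  have hchar := AnosovLie.charpoly_scaleEquiv_map (c := c) hE hσ h1 lam hlam0
  have habs0 : |(lam : ℝ)| = lam := abs_of_pos (by linarith)
  have hper : ∀ k, |(((σ ^ (k + 2 * n)) lam : E) : ℝ)| = |(((σ ^ k) lam : E) : ℝ)| := fun k => by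
    rw [pow_add, hpow, mul_one]
  have hpos : ∀ k, 0 < |(((σ ^ k) lam : E) : ℝ)| := fun k => by
    rw [abs_pos]
    exact_mod_cast (map_ne_zero (σ ^ k)).mpr hlam0
  have hlt : ∀ k, ¬ 2 * n ∣ k → |(((σ ^ k) lam : E) : ℝ)| < 1 := fun k hk => by
    refine hconj _ fun h => hk ?_
    rw [← hord]
    exact orderOf_dvd_of_pow_eq_one h
  have h0 : |(((σ ^ 0) lam : E) : ℝ)| = lam := by rw [pow_zero, AlgEquiv.one_apply, habs0]
  have habs : ∀ i j : ℕ, |((((σ ^ i) lam) ^ (j - 1) * (σ ^ (i + n)) lam : E) : ℝ)| =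
      |(((σ ^ i) lam : E) : ℝ)| ^ (j - 1) * |(((σ ^ (i + n)) lam : E) : ℝ)| := fun i j => by
    push_cast
    rw [abs_mul, abs_pow]
  obtain ⟨hhyp, hleast⟩ := AnosovLie.isHyperbolic_and_isLeast_signature
    (r := AnosovLie.expandingIndex n) hchar
    (fun j _ => AnosovLie.two_le_minimalTypeEntry hn j)
    (fun j _ => AnosovLie.expandingIndex_mem hn)
    (fun j hj => by
      rw [habs]
      exact AnosovLie.one_lt_expanding hper hpos (by rwa [h0]) (by rwa [h0])
        (Finset.mem_Icc.mp hj).1)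
    (fun j hj i hi hij => by
      rw [habs]
      exact AnosovLie.contracting_lt_one hper hpos hlt hn (by rwa [h0])
        (Finset.mem_Icc.mp hj).1 hi hij)
  have hσint : ∀ k, IsIntegral ℤ ((σ ^ k) lam) := fun k =>
    hint.map ((σ ^ k).toAlgHom.restrictScalars ℤ)
  have hσint' : ∀ k, IsIntegral ℤ ((σ ^ k) lam)⁻¹ := fun k => by
    rw [← map_inv₀]
    exact hint'.map ((σ ^ k).toAlgHom.restrictScalars ℤ)
  have hintlike := AnosovLie.isIntegerLike_of_charpoly_eq_prod
    (hchar.trans (Finset.prod_sigma' _ _ _))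
    (fun p => ((hσint _).pow _).mul (hσint _))
    (fun p => by
      rw [mul_inv, ← inv_pow]
      exact ((hσint' _).pow _).mul (hσint' _))
  exact ⟨E, σ, lam, AnosovLie.CyclicLie (σ ^ n) c, inferInstance, inferInstance, inferInstance,
    AnosovLie.CyclicLie.scaleEquiv lam hlam0, ⟨hE, hGal, hσ⟩, hlam,
    AnosovLie.CyclicLie.hasNilpotencyClass h1 hc, AnosovLie.CyclicLie.lieType_eq h1 hE hc,
    ⟨hhyp, hintlike⟩, hleast, hchar⟩
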